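/- Let $K$ be a compact connected abelian subgroup of $SO(d)$ with normalized Haar measure $\omega_K$, and let $\mathfrak k=\{X : \exp(tX)\in K \text{ for all } t\in\mathbb R\}$ be its Lie algebra, of dimension $r$. Fix linear coordinates on $\mathfrak k$ coming from an identification of $K$ with the torus $(\mathbb R/\mathbb Z)^r$; that is, a basis $u_1,\dots,u_r$ of $\mathfrak k$ such that $\exp(\sum_k t_k u_k)=1$ if and only if all $t_k\in\mathbb Z$. Let $v_1,\dots,v_r$ be a basis of $\mathfrak k$ such that $v_k=\theta_k u_k$ with $\theta_k$ irrational, and put $e_k=\exp(v_k)\in K$ (an irrational rotation in the $k$-th coordinate of $K$). Let $(E,\mathcal A,\rho)$ be a probability space, $\tau:E\to E$ a transformation, and $f_1,\dots,f_r:E\to[0,\frac1r]$ functions. Assume that at least one of the following holds: (a) $r\ge 2$ and $1,\theta_1,\dots,\theta_r$ are linearly independent over $\mathbb Q$; (b) for every $k$, $f_k$ is not $\rho$-almost everywhere $\{0,\frac1r\}$-valued, and $g_k=f_k(\frac1r-f_k)$ is in the class $\mathcal C_2$, i.e. $g_k\in L^1(\rho)$ and $\sup_{x\in E}\bigl|\sum_{i=1}^n\bigl(g_k(\tau^i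 x)-\int_E g_k\,d\rho\bigr)\bigr|=o(\sqrt n)$. For $x\in E$ let $R_1,R_2,\dots$ be independent $K$-valued random variables with $$P(R_j=e_k)=f_k(\tau^jx),\qquad P(R_j=e_k^{-1})=\tfrac1r-f_k(\tau^jx)\qquad(1\le k\le r).$$ Then for $\rho$-almost every $x$ the products $R_1R_2\cdots R_n$ converge in law, as $n\to\infty$, to $\omega_K$. -/

import Mathlib

open MeasureTheory ProbabilityTheory Filter Topology

/-- The special orthogonal group `SO(d)`, with the topology of matrices. -/
abbrev SO (d : ℕ) : Type := Matrix.specialOrthogonalGroup (Fin d) ℝ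

/-- The Lie algebra of a (closed) subgroup `K` of `SO(d)`: the matrices `X` whose one-parameter
group `t ↦ exp (tX)` stays in `K`. -/
def lieAlgebraOf {d : ℕ} (K : Subgroup (SO d)) : Set (Matrix (Fin d) (Fin d) ℝ) :=
  {X | ∀ t : ℝ, ∃ g ∈ K, (g : Matrix (Fin d) (Fin d) ℝ) = NormedSpace.exp (t • X)}

/-- The family `v` is a basis (over `ℝ`) of the Lie algebra of `K`. -/
structure IsLieBasis {d r : ℕ} (K : Subgroup (SO d))
    (v : Fin r → Matrix (Fin d) (Fin d) ℝ) : Prop where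
  linearIndependent : LinearIndependent ℝ v
  span_eq : (Submodule.span ℝ (Set.range v) : Set (Matrix (Fin d) (Fin d) ℝ)) = lieAlgebraOf K

/-- A basis `u` of the Lie algebra of the torus `K` that generates the lattice `ker exp`.
Such a basis is the same as an identification of `K` with `(ℝ/ℤ)^r`: the point with
coordinates `t` in the Lie algebra is `∑ k, t k • u k`, and its exponential corresponds to the
class of `t` modulo `ℤ^r`, that is to `(e^{2πi t_1}, …, e^{2πi t_r})`. -/
structure IsTorusCoordinates {d r : ℕ} (K : Subgroup (SO d))
    (u : Fin r → Matrix (Fin d) (Fin d) ℝ) : Prop where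
  isLieBasis : IsLieBasis K u
  exp_eq_one_iff : ∀ t : Fin r → ℝ,
    NormedSpace.exp (∑ k, t k • u k) = 1 ↔ ∀ k, ∃ m : ℤ, t k = m

/-- The class `𝒞₂(S)` of the dynamical system `S = (E, 𝒜, ρ, τ)`: the integrable `g` with
`sup_x |∑_{i=1}^n (g (τ^i x) - ∫ g dρ)| = o(√n)`. -/
def ClassC2 {E : Type*} [MeasurableSpace E] (ρ : Measure E) (τ : E → E) (g : E → ℝ) : Prop :=
  Integrable g ρ ∧
    ∀ ε : ℝ, 0 < ε → ∃ N : ℕ, ∀ n : ℕ, N ≤ n → ∀ x : E,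
      |∑ i ∈ Finset.Icc 1 n, (g (τ^[i] x) - ∫ y, g y ∂ρ)| ≤ ε * Real.sqrt n

/-- The law of one step at the environment `y`: mass `f_k y` at `e_k` and `1/r - f_k y` at
`e_k⁻¹`, for each `k`. -/
noncomputable def stepLaw {G E : Type*} [Group G] [MeasurableSpace G] {r : ℕ}
    (e : Fin r → G) (f : Fin r → E → ℝ) (y : E) : Measure G :=
  ∑ k, (ENNReal.ofReal (f k y) • Measure.dirac (e k) +
    ENNReal.ofReal (1 / r - f k y) • Measure.dirac (e k)⁻¹)

/-- `R 1, R 2, …` are the steps of the dynamic walk started at the environment `x`: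
independent, and `R j` has the step law at `τ^j x`. (`R 0` plays no role.) -/
structure IsDynamicWalk {G E Ω : Type*} [Group G] [MeasurableSpace G] [MeasurableSpace Ω] {r : ℕ}
    (e : Fin r → G) (f : Fin r → E → ℝ) (τ : E → E) (x : E)
    (P : Measure Ω) (R : ℕ → Ω → G) : Prop where
  indep : iIndepFun (fun j => R (j + 1)) P
  law : ∀ j, 1 ≤ j → HasLaw (R j) (stepLaw e f (τ^[j] x)) P

/-! ### Closed subgroups and their Lie algebras near the identity -/

section ClosedSubgroup

open NormedSpace

/-! The proof is Fourier analysis on a torus. The Lie algebra of `K` is commutative, and the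
exponential maps it onto `K`, so the coordinates `u` identify `K` with `(ℝ/ℤ)^r`
(`exists_torus_homeomorph`). Characters span a dense subspace of `C(K, ℂ)`, so it suffices that `E
χ_m(R_1 ⋯ R_n) → 0` for each frequency `m ≠ 0` (`ProbabilityMeasure.tendsto_of_span_dense`). By
independence this expectation is a product over `j` of the sums over `k` of `f_k z_k + (1/r - f_k)
conj z_k`, with `z_k = exp(2πi m_k θ_k)` and `f_k` taken at `τ^j x`.

Fix `k` with `m_k ≠ 0`. The `k`-th summand has real part `Re z_k / r`, whatever `f_k` is. In case
(a), rational independence gives `Re z_k ≠ Re z_l` for any `l ≠ k`; the two summands stay apart, and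
the parallelogram law bounds every factor by one constant `q < 1` (`norm_sum_stepTerm_le`). In case
(b), `Im z_k ≠ 0`, and the modulus of the `k`-th summand falls short of `1/r` by at least `2r (Im
z_k)² g_k`; the product is at most the exponential of `-2r (Im z_k)² ∑ g_k(τ^j x)`, whose sum
diverges because `g_k` has positive mean (`norm_sum_stepTerm_le_exp`, `ClassC2.tendsto_sum_atTop`).
Both arguments work for every `x`. -/

theorem commute_of_mem_adjoin {R A : Type*} [CommSemiring R] [Semiring A] [Algebra R A]
    (H : Submonoid A) (hcomm : ∀ a ∈ H, ∀ b ∈ H, Commute a b) {X Y : A}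
    (hX : X ∈ Algebra.adjoin R (H : Set A)) (hY : Y ∈ Algebra.adjoin R (H : Set A)) :
    Commute X Y :=
  Algebra.commute_of_mem_adjoin_of_forall_mem_commute hY fun b hb =>
    (Algebra.commute_of_mem_adjoin_of_forall_mem_commute hX fun a ha => hcomm b hb a ha).symm

variable {A : Type*} [NormedRing A] [NormedAlgebra ℝ A]

section Complete

variable [CompleteSpace A]

theorem exp_zsmul_mem (H : Submonoid A) (hinv : ∀ x, exp x ∈ H → exp (-x) ∈ H)
    {x : A} (hx : exp x ∈ H) (n : ℤ) : exp (n • x) ∈ H := by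
  let _ : NormedAlgebra ℚ A := NormedAlgebra.restrictScalars ℚ ℝ A
  obtain ⟨k, rfl | rfl⟩ := n.eq_nat_or_neg
  · rw [natCast_zsmul, exp_nsmul]
    exact pow_mem hx k
  · rw [neg_smul, natCast_zsmul]
    apply hinv
    rw [exp_nsmul]
    exact pow_mem hx k

/-- If the directions of `z i → 0` converge to `w`, and all `exp (z i)` lie in a closed subgroup,
then so does the one-parameter group generated by `w`. -/
theorem exp_smul_mem_of_tendsto_direction {ι : Type*} {l : Filter ι} [l.NeBot] (H : Submonoid A)
    (hH : IsClosed (H : Set A)) (hinv : ∀ x, exp x ∈ H → exp (-x) ∈ H) {z : ι → A} {w : A}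
    (hz : Tendsto z l (𝓝 0)) (hzH : ∀ᶠ i in l, exp (z i) ∈ H)
    (hw : Tendsto (fun i => ‖z i‖⁻¹ • z i) l (𝓝 w)) (t : ℝ) : exp (t • w) ∈ H := by
  let _ : NormedAlgebra ℚ A := NormedAlgebra.restrictScalars ℚ ℝ A
  -- Integer multiples of `z i` keep the exponential in `H`; rounding `t / ‖z i‖` down costs at most
  -- `‖z i‖ → 0`.
  have hlim : Tendsto (fun i => (⌊t / ‖z i‖⌋ : ℤ) • z i) l (𝓝 (t • w)) := by
    have h1 : Tendsto (fun i => (Int.fract (t / ‖z i‖)) • z i) l (𝓝 0) := by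
      rw [tendsto_zero_iff_norm_tendsto_zero]
      refine squeeze_zero (fun _ => norm_nonneg _) (fun i => ?_)
        (tendsto_zero_iff_norm_tendsto_zero.1 hz)
      rw [norm_smul, Real.norm_of_nonneg (Int.fract_nonneg _)]
      exact mul_le_of_le_one_left (norm_nonneg _) (Int.fract_lt_one _).le
    have h2 : Tendsto (fun i => t • (‖z i‖⁻¹ • z i) - (Int.fract (t / ‖z i‖)) • z i) l
        (𝓝 (t • w - 0)) := (hw.const_smul t).sub h1
    rw [sub_zero] at h2
    refine h2.congr fun i => ?_
    rw [smul_smul, ← sub_smul, ← div_eq_mul_inv, Int.self_sub_fract, Int.cast_smul_eq_zsmul]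
  exact hH.mem_of_tendsto (hlim.exp) (hzH.mono fun i hi => exp_zsmul_mem H hinv hi _)

/-- Near `1`, a closed subgroup of the units of a commutative finite-dimensional algebra consists of
exponentials of elements of its Lie algebra. -/
theorem eventually_mem_exp_image [FiniteDimensional ℝ A] (hcomm : ∀ a b : A, Commute a b)
    (H : Submonoid A) (hH : IsClosed (H : Set A)) (hinv : ∀ x, exp x ∈ H → exp (-x) ∈ H)
    (L : Submodule ℝ A) (hL : ∀ X, X ∈ L ↔ ∀ t : ℝ, exp (t • X) ∈ H) :
    ∀ᶠ y in 𝓝 (1 : A), y ∈ H → ∃ X ∈ L, exp X = y := by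
  let _ : NormedAlgebra ℚ A := NormedAlgebra.restrictScalars ℚ ℝ A
  have hmap : map exp (𝓝 (0 : A)) = 𝓝 1 := by
    have h := (hasStrictFDerivAt_exp_zero (𝕂 := ℝ) (𝔸 := A)).map_nhds_eq_of_surj
      (LinearMap.range_eq_top.2 fun x => ⟨x, rfl⟩)
    rwa [exp_zero] at h
  rw [← hmap, eventually_map]
  by_contra hcon
  rw [not_eventually] at hcon
  obtain ⟨V, hV⟩ := L.exists_isCompl
  let p : A →L[ℝ] L := LinearMap.toContinuousLinearMap (L.projectionOnto V hV)
  -- The component of `x` transverse to `L`. Since everything commutes, `exp (z x) = exp x * exp (-p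
  -- x)`, which lies in `H` as soon as `exp x` does.
  let z : A → A := fun x => x - p x
  have hzV : ∀ x, z x ∈ V := fun x => by
    have : p (z x) = 0 := by
      simp only [z, map_sub, p, LinearMap.coe_toContinuousLinearMap', sub_eq_zero]
      exact (Submodule.projectionOnto_apply_left hV _).symm
    exact (Submodule.projectionOnto_apply_eq_zero_iff hV).1 this
  have hzc : Continuous z := by fun_prop
  have hz0 : Tendsto z (𝓝 0) (𝓝 0) := by
    have := hzc.tendsto 0
    simpa [z] using this
  rw [frequently_iff_neBot] at hcon
  set F := 𝓝 (0 : A) ⊓ 𝓟 {x | ¬(exp x ∈ H → ∃ X ∈ L, exp X = exp x)} with hF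
  -- An ultrafilter of counterexamples plays the role of a convergent subsequence: the directions of
  -- `z x` converge on the unit sphere to some `w`, which lies in both `L` and `V`.
  let f : Ultrafilter A := Ultrafilter.of F
  have hfF : (f : Filter A) ≤ F := Ultrafilter.of_le F
  have hfS : ∀ᶠ x in (f : Filter A), ¬(exp x ∈ H → ∃ X ∈ L, exp X = exp x) :=
    (hfF.trans inf_le_right) (mem_principal_self _)
  have hzne : ∀ᶠ x in (f : Filter A), z x ≠ 0 := hfS.mono fun x hx h0 => by
    apply hx
    intro _
    exact ⟨x, by rw [sub_eq_zero.1 h0]; exact (p x).2, rfl⟩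
  have hzH : ∀ᶠ x in (f : Filter A), exp (z x) ∈ H := hfS.mono fun x hx => by
    push Not at hx
    have h1 : exp (z x) = exp x * exp (-(p x : A)) := by
      rw [← exp_add_of_commute (hcomm _ _), ← sub_eq_add_neg]
    rw [h1]
    refine H.mul_mem hx.1 ?_
    have := (hL _).1 (p x).2 (-1)
    rwa [neg_one_smul] at this
  have hsph : Metric.sphere (0 : A) 1 ∈ f.map (fun x => ‖z x‖⁻¹ • z x) := by
    rw [Ultrafilter.mem_map]
    filter_upwards [hzne] with x hx
    simp [norm_smul, hx]
  have : ProperSpace A := FiniteDimensional.proper ℝ A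
  obtain ⟨w, hw, hlim⟩ := (isCompact_sphere (0 : A) 1).ultrafilter_le_nhds' _ hsph
  have hwL : w ∈ L := (hL w).2 fun t =>
    exp_smul_mem_of_tendsto_direction (l := (f : Filter A)) H hH hinv
      (hz0.mono_left (hfF.trans inf_le_left)) hzH hlim t
  have hwV : w ∈ V := V.closed_of_finiteDimensional.mem_of_tendsto
    (show Tendsto (fun x => ‖z x‖⁻¹ • z x) (f : Filter A) (𝓝 w) from hlim)
    (Eventually.of_forall fun x => V.smul_mem _ (hzV x))
  have : w = 0 := Submodule.disjoint_def.1 hV.disjoint w hwL hwV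
  simp [this] at hw

/-- A closed linear subspace containing a one-parameter group contains its generator. -/
theorem mem_of_exp_smul_mem (S : Submodule ℝ A) (hS : IsClosed (S : Set A)) {X : A}
    (hX : ∀ t : ℝ, exp (t • X) ∈ S) : X ∈ S := by
  have hd : HasDerivAt (fun t : ℝ => exp (t • X)) X 0 := by
    have := hasDerivAt_exp_smul_const (𝕂 := ℝ) X (0 : ℝ)
    simpa using this
  rw [hasDerivAt_iff_tendsto_slope] at hd
  refine hS.mem_of_tendsto hd (Eventually.of_forall fun t => ?_)
  rw [slope_def_module]
  exact S.smul_mem _ (S.sub_mem (hX _) (hX _))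

/-- The Lie algebra of a group lies in the algebra generated by the group. -/
theorem mem_adjoin_of_exp_smul_mem [FiniteDimensional ℝ A] (H : Submonoid A) {X : A}
    (hX : ∀ t : ℝ, exp (t • X) ∈ H) : X ∈ Algebra.adjoin ℝ (H : Set A) :=
  mem_of_exp_smul_mem (Subalgebra.toSubmodule (Algebra.adjoin ℝ (H : Set A)))
    (Submodule.closed_of_finiteDimensional _) fun t => Algebra.subset_adjoin (hX t)

end Complete

/-- Near `1`, a commutative closed subgroup of the units of a finite-dimensional algebra consists of
exponentials of elements of its Lie algebra. -/
theorem eventually_mem_exp_image_of_commute [FiniteDimensional ℝ A]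
    (H : Submonoid A) (hcomm : ∀ a ∈ H, ∀ b ∈ H, Commute a b)
    (hH : IsClosed (H : Set A)) (hinv : ∀ x, exp x ∈ H → exp (-x) ∈ H)
    (L : Submodule ℝ A) (hL : ∀ X, X ∈ L ↔ ∀ t : ℝ, exp (t • X) ∈ H) :
    ∀ᶠ y in 𝓝 (1 : A), y ∈ H → ∃ X ∈ L, exp X = y := by
  -- The algebra generated by `H` is commutative, so transverse components taken inside it commute
  -- with the rest, as the previous argument requires.
  let S := Algebra.adjoin ℝ (H : Set A)
  have : CompleteSpace A := FiniteDimensional.complete ℝ _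
  have : CompleteSpace S := FiniteDimensional.complete ℝ _
  let _ : NormedAlgebra ℚ S := NormedAlgebra.restrictScalars ℚ ℝ _
  let _ : NormedAlgebra ℚ A := NormedAlgebra.restrictScalars ℚ ℝ _
  have hexp : ∀ X : S, ((exp X : S) : A) = exp (X : A) := fun X =>
    map_exp S.val continuous_subtype_val X
  have h := eventually_mem_exp_image (A := S)
    (fun a b => Subtype.ext (commute_of_mem_adjoin H hcomm a.2 b.2))
    (H.comap S.val) (hH.preimage continuous_subtype_val)
    (fun x hx => by
      rw [Submonoid.mem_comap, Subalgebra.coe_val, hexp] at hx ⊢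
      exact hinv _ hx)
    (L.comap S.val.toLinearMap)
    (fun X => by
      rw [Submodule.mem_comap, hL]
      refine forall_congr' fun t => ?_
      rw [Submonoid.mem_comap, Subalgebra.coe_val, hexp]
      rfl)
  rw [nhds_subtype_eq_comap, eventually_comap] at h
  filter_upwards [h] with y hy hyH
  obtain ⟨X, hX, hXy⟩ := hy ⟨y, Algebra.subset_adjoin hyH⟩ rfl hyH
  exact ⟨X, hX, by rw [← hexp, hXy]⟩

end ClosedSubgroup

/-! ### Surjectivity of the exponential and torus coordinates -/

section TorusSurjectivity

open NormedSpace

attribute [local instance] Matrix.linftyOpNormedRing Matrix.linftyOpNormedAlgebra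

variable {d : ℕ} (K : Subgroup (SO d))

/-- The matrices of the elements of a subgroup of `SO(d)`. -/
def matrixSubmonoid : Submonoid (Matrix (Fin d) (Fin d) ℝ) :=
  K.toSubmonoid.map (Submonoid.subtype (Matrix.specialOrthogonalGroup (Fin d) ℝ))

theorem mem_matrixSubmonoid {M : Matrix (Fin d) (Fin d) ℝ} :
    M ∈ matrixSubmonoid K ↔ ∃ g ∈ K, (g : Matrix (Fin d) (Fin d) ℝ) = M := Iff.rfl

theorem mem_lieAlgebraOf {X : Matrix (Fin d) (Fin d) ℝ} :
    X ∈ lieAlgebraOf K ↔ ∀ t : ℝ, exp (t • X) ∈ matrixSubmonoid K := Iff.rfl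

theorem isClosed_matrixSubmonoid (hK : IsCompact (K : Set (SO d))) :
    IsClosed (matrixSubmonoid K : Set (Matrix (Fin d) (Fin d) ℝ)) :=
  (hK.image continuous_subtype_val).isClosed

theorem exp_neg_mem_matrixSubmonoid {X : Matrix (Fin d) (Fin d) ℝ}
    (hX : exp X ∈ matrixSubmonoid K) : exp (-X) ∈ matrixSubmonoid K := by
  obtain ⟨g, hg, hgX⟩ := (mem_matrixSubmonoid K).1 hX
  refine (mem_matrixSubmonoid K).2 ⟨g⁻¹, K.inv_mem hg, ?_⟩
  rw [Matrix.exp_neg, ← hgX]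
  refine (Matrix.inv_eq_left_inv ?_).symm
  exact congrArg Subtype.val (inv_mul_cancel g)

theorem commute_of_mem_matrixSubmonoid (hcomm : ∀ a ∈ K, ∀ b ∈ K, a * b = b * a) :
    ∀ a ∈ matrixSubmonoid K, ∀ b ∈ matrixSubmonoid K, Commute a b := by
  rintro _ ⟨g, hg, rfl⟩ _ ⟨h, hh, rfl⟩
  exact congrArg Subtype.val (hcomm g hg h hh)

theorem commute_of_mem_lieAlgebraOf (hcomm : ∀ a ∈ K, ∀ b ∈ K, a * b = b * a)
    {X Y : Matrix (Fin d) (Fin d) ℝ} (hX : X ∈ lieAlgebraOf K) (hY : Y ∈ lieAlgebraOf K) :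
    Commute X Y :=
  commute_of_mem_adjoin _ (commute_of_mem_matrixSubmonoid K hcomm)
    (mem_adjoin_of_exp_smul_mem _ ((mem_lieAlgebraOf K).1 hX))
    (mem_adjoin_of_exp_smul_mem _ ((mem_lieAlgebraOf K).1 hY))

/-- Near `1`, the elements of a compact abelian group of matrices are exponentials of elements of
its Lie algebra. -/
theorem eventually_exists_exp_eq (hK : IsCompact (K : Set (SO d)))
    (hcomm : ∀ a ∈ K, ∀ b ∈ K, a * b = b * a)
    (L : Submodule ℝ (Matrix (Fin d) (Fin d) ℝ)) (hL : (L : Set _) = lieAlgebraOf K) :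
    ∀ᶠ g : K in 𝓝 (1 : K), ∃ X ∈ L, exp X = ((g : SO d) : Matrix (Fin d) (Fin d) ℝ) := by
  have h := eventually_mem_exp_image_of_commute (matrixSubmonoid K)
    (commute_of_mem_matrixSubmonoid K hcomm) (isClosed_matrixSubmonoid K hK)
    (fun _ => exp_neg_mem_matrixSubmonoid K) L
    (fun X => (Set.ext_iff.1 hL X).trans (mem_lieAlgebraOf K))
  have h1 : Tendsto (fun g : K => ((g : SO d) : Matrix (Fin d) (Fin d) ℝ)) (𝓝 1) (𝓝 1) :=
    (continuous_subtype_val.comp continuous_subtype_val).tendsto' _ _ rfl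
  filter_upwards [h1.eventually h] with g hg
  exact hg ⟨g, g.2, rfl⟩

/-- The exponential map of a compact connected abelian group of matrices is surjective. -/
theorem exists_exp_eq (hK : IsCompact (K : Set (SO d))) (hconn : IsConnected (K : Set (SO d)))
    (hcomm : ∀ a ∈ K, ∀ b ∈ K, a * b = b * a)
    (L : Submodule ℝ (Matrix (Fin d) (Fin d) ℝ)) (hL : (L : Set _) = lieAlgebraOf K) (g : K) :
    ∃ X ∈ L, exp X = ((g : SO d) : Matrix (Fin d) (Fin d) ℝ) := by
  have hLcomm : ∀ X ∈ L, ∀ Y ∈ L, Commute X Y := fun X hX Y hY =>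
    commute_of_mem_lieAlgebraOf K hcomm (hL ▸ hX) (hL ▸ hY)
  -- The image of the exponential is a subgroup containing a neighbourhood of `1`, hence clopen in
  -- the connected group `K`.
  let T : Subgroup K :=
    { carrier := {g | ∃ X ∈ L, exp X = ((g : SO d) : Matrix (Fin d) (Fin d) ℝ)}
      mul_mem' := by
        rintro a b ⟨X, hX, hXa⟩ ⟨Y, hY, hYb⟩
        refine ⟨X + Y, L.add_mem hX hY, ?_⟩
        rw [Matrix.exp_add_of_commute _ _ (hLcomm X hX Y hY), hXa, hYb]
        rfl
      one_mem' := ⟨0, L.zero_mem, by rw [exp_zero]; rfl⟩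
      inv_mem' := by
        rintro a ⟨X, hX, hXa⟩
        refine ⟨-X, L.neg_mem hX, ?_⟩
        rw [Matrix.exp_neg, hXa]
        refine Matrix.inv_eq_left_inv ?_
        exact congrArg (fun g : K => ((g : SO d) : Matrix (Fin d) (Fin d) ℝ)) (inv_mul_cancel a) }
  have : ContinuousMul K := K.toSubmonoid.continuousMul
  have : ConnectedSpace K := isConnected_iff_connectedSpace.1 hconn
  have hopen : IsOpen (T : Set K) :=
    T.isOpen_of_mem_nhds (g := 1) (eventually_exists_exp_eq K hK hcomm L hL)
  have huniv : (T : Set K) = Set.univ :=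
    IsClopen.eq_univ ⟨T.isClosed_of_isOpen hopen, hopen⟩ ⟨1, T.one_mem⟩
  exact huniv.ge (Set.mem_univ g)

/-- Torus coordinates identify `K` with the standard torus. -/
theorem exists_torus_homeomorph {r : ℕ} (hK : IsCompact (K : Set (SO d)))
    (hconn : IsConnected (K : Set (SO d))) (hcomm : ∀ a ∈ K, ∀ b ∈ K, a * b = b * a)
    (u : Fin r → Matrix (Fin d) (Fin d) ℝ) (hu : IsTorusCoordinates K u) :
    ∃ ψ : UnitAddTorus (Fin r) ≃ₜ K, (∀ x y, ψ (x + y) = ψ x * ψ y) ∧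
      ∀ t : Fin r → ℝ, ((ψ (fun k => (t k : UnitAddCircle)) : SO d) : Matrix (Fin d) (Fin d) ℝ) =
        exp (∑ k, t k • u k) := by
  let _ : NormedAlgebra ℚ (Matrix (Fin d) (Fin d) ℝ) := NormedAlgebra.restrictScalars ℚ ℝ _
  have hmem : ∀ t : Fin r → ℝ, ∑ k, t k • u k ∈ lieAlgebraOf K := fun t => by
    rw [← hu.isLieBasis.span_eq]
    exact Submodule.sum_mem _ fun k _ => Submodule.smul_mem _ _ (Submodule.subset_span ⟨k, rfl⟩)
  have hex : ∀ t : Fin r → ℝ, ∃ g : K,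
      ((g : SO d) : Matrix (Fin d) (Fin d) ℝ) = exp (∑ k, t k • u k) := fun t => by
    obtain ⟨g, hg, hgt⟩ := hmem t 1
    exact ⟨⟨g, hg⟩, by rw [hgt, one_smul]⟩
  choose φ hφ using hex
  have hinj : ∀ {a b : K}, ((a : SO d) : Matrix (Fin d) (Fin d) ℝ) = ((b : SO d) : Matrix _ _ ℝ) →
      a = b := fun h => Subtype.ext (Subtype.ext h)
  have hadd : ∀ s t, φ (s + t) = φ s * φ t := fun s t => hinj <| by
    have h : ((φ s * φ t : K) : SO d) = (φ s : SO d) * (φ t : SO d) := rfl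
    rw [h, Submonoid.coe_mul, hφ, hφ, hφ, ← Matrix.exp_add_of_commute _ _
      (commute_of_mem_lieAlgebraOf K hcomm (hmem s) (hmem t)), ← Finset.sum_add_distrib]
    simp [add_smul]
  have hone : ∀ t, φ t = 1 ↔ ∀ k, ∃ m : ℤ, t k = m := fun t => by
    rw [← hu.exp_eq_one_iff t, ← hφ]
    exact ⟨fun h => by rw [h]; rfl, fun h => hinj h⟩
  have hcont : Continuous φ := by
    have h : Continuous fun t => ((φ t : SO d) : Matrix (Fin d) (Fin d) ℝ) := by
      simp_rw [hφ]
      exact (exp_continuous (𝔸 := Matrix (Fin d) (Fin d) ℝ)).comp (by fun_prop)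
    exact (h.subtype_mk _).subtype_mk _
  have hsurj : Function.Surjective φ := fun g => by
    obtain ⟨X, hX, hXg⟩ := exists_exp_eq K hK hconn hcomm _ hu.isLieBasis.span_eq g
    obtain ⟨t, rfl⟩ := (Submodule.mem_span_range_iff_exists_fun ℝ).1 hX
    exact ⟨t, hinj (by rw [hφ, hXg])⟩
  have hker : ∀ s t, φ s = φ t ↔ ∀ k, (s k : UnitAddCircle) = (t k : UnitAddCircle) := fun s t => by
    have h1 : φ s = φ (s - t) * φ t := by rw [← hadd, sub_add_cancel]
    rw [h1, mul_eq_right, hone]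
    refine forall_congr' fun k => ?_
    rw [← sub_eq_zero (a := (s k : UnitAddCircle)), ← AddCircle.coe_sub, AddCircle.coe_eq_zero_iff]
    simp [eq_comm]
  let q : C(Fin r → ℝ, UnitAddTorus (Fin r)) :=
    ⟨Pi.map fun _ t => (t : UnitAddCircle), by fun_prop⟩
  -- As `q` is a quotient map, `φ` descends to a continuous bijection from a compact space to a
  -- Hausdorff one.
  have hq : IsOpenQuotientMap q := IsOpenQuotientMap.piMap fun _ =>
    QuotientAddGroup.isOpenQuotientMap_mk
  have hfac : Function.FactorsThrough (⟨φ, hcont⟩ : C(Fin r → ℝ, K)) q := fun s t h =>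
    (hker s t).2 fun k => congrFun h k
  let ψ : C(UnitAddTorus (Fin r), K) := hq.isQuotientMap.lift ⟨φ, hcont⟩ hfac
  have hψ : ∀ t, ψ (q t) = φ t := fun t =>
    DFunLike.congr_fun (hq.isQuotientMap.lift_comp ⟨φ, hcont⟩ hfac) t
  have hbij : Function.Bijective ψ := by
    constructor
    · intro x y hxy
      obtain ⟨s, rfl⟩ := hq.surjective x
      obtain ⟨t, rfl⟩ := hq.surjective y
      rw [hψ, hψ, hker] at hxy
      exact funext hxy
    · intro g
      obtain ⟨t, rfl⟩ := hsurj g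
      exact ⟨q t, hψ t⟩
  let e : UnitAddTorus (Fin r) ≃ₜ K :=
    Continuous.homeoOfEquivCompactToT2 (f := Equiv.ofBijective ψ hbij) ψ.continuous
  refine ⟨e, fun x y => ?_, fun t => ?_⟩
  · obtain ⟨s, rfl⟩ := hq.surjective x
    obtain ⟨t, rfl⟩ := hq.surjective y
    change ψ (q (s + t)) = ψ (q s) * ψ (q t)
    rw [hψ, hψ, hψ, hadd]
  · rw [← hφ, ← hψ]
    rfl

end TorusSurjectivity

/-! ### Weak convergence tested on a spanning family -/

section WeakConvergence

/-- On a compact space, convergence of the integrals of a family of functions with dense span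
implies weak convergence. -/
theorem ProbabilityMeasure.tendsto_of_span_dense {K ι : Type*} [TopologicalSpace K] [CompactSpace K]
    [MeasurableSpace K] [OpensMeasurableSpace K] {l : Filter ι}
    {μ : ι → ProbabilityMeasure K} {ν : ProbabilityMeasure K} {S : Set C(K, ℂ)}
    (hS : (Submodule.span ℂ S).topologicalClosure = ⊤)
    (h : ∀ F ∈ S, Tendsto (fun i => ∫ x, F x ∂(μ i : Measure K)) l (𝓝 (∫ x, F x ∂(ν : Measure K)))) :
    Tendsto μ l (𝓝 ν) := by
  have hint : ∀ (η : ProbabilityMeasure K) (F : C(K, ℂ)), Integrable F (η : Measure K) :=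
    fun η F => (BoundedContinuousFunction.mkOfCompact F).integrable _
  have hspan : ∀ F ∈ Submodule.span ℂ S, Tendsto (fun i => ∫ x, F x ∂(μ i : Measure K)) l
      (𝓝 (∫ x, F x ∂(ν : Measure K))) := fun F hF => by
    induction hF using Submodule.span_induction with
    | mem F hF => exact h F hF
    | zero => simpa using tendsto_const_nhds
    | add F G _ _ hF hG =>
      simp only [ContinuousMap.add_apply]
      rw [integral_add (hint ν F) (hint ν G)]
      simp_rw [integral_add (hint (μ _) F) (hint (μ _) G)]
      exact hF.add hG
    | smul c F _ hF =>
      simp only [ContinuousMap.smul_apply, integral_smul]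
      exact hF.const_smul c
  have hdist : ∀ (η : ProbabilityMeasure K) (F G : C(K, ℂ)),
      dist (∫ x, F x ∂(η : Measure K)) (∫ x, G x ∂(η : Measure K)) ≤ dist F G := fun η F G => by
    rw [dist_eq_norm, ← integral_sub (hint η F) (hint η G)]
    refine (norm_integral_le_of_norm_le_const (C := dist F G) (Eventually.of_forall fun x => ?_)).trans
      (by simp)
    rw [← dist_eq_norm]
    exact ContinuousMap.dist_apply_le_dist x
  rw [ProbabilityMeasure.tendsto_iff_forall_integral_rclike_tendsto ℂ]
  intro F
  rw [Metric.tendsto_nhds]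
  intro ε hε
  have hF : F.toContinuousMap ∈ closure (Submodule.span ℂ S : Set C(K, ℂ)) := by
    rw [← Submodule.topologicalClosure_coe, hS]
    trivial
  obtain ⟨G, hG, hFG⟩ := Metric.mem_closure_iff.1 hF (ε / 3) (by positivity)
  filter_upwards [Metric.tendsto_nhds.1 (hspan G hG) (ε / 3) (by positivity)] with i hi
  have h1 := hdist (μ i) F.toContinuousMap G
  have h2 := hdist ν G F.toContinuousMap
  rw [dist_comm] at h2
  rw [dist_comm G] at h2
  have h3 := dist_triangle4 (∫ x, F x ∂(μ i : Measure K)) (∫ x, G x ∂(μ i : Measure K))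
    (∫ x, G x ∂(ν : Measure K)) (∫ x, F x ∂(ν : Measure K))
  rw [dist_comm (∫ x, G x ∂(ν : Measure K)) (∫ x, F x ∂(ν : Measure K))] at h3
  simp only [BoundedContinuousFunction.coe_toContinuousMap] at h1 h2
  linarith

theorem integral_monoidHom_eq_zero {K : Type*} [Group K] [MeasurableSpace K] [MeasurableMul K]
    (μ : Measure K) [μ.IsMulLeftInvariant] (χ : K →* ℂ) {g : K} (hg : χ g ≠ 1) :
    ∫ x, χ x ∂μ = 0 := by
  have h := integral_mul_left_eq_self (μ := μ) (fun x => χ x) g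
  simp only [map_mul, integral_const_mul] at h
  by_contra h0
  exact hg (mul_right_cancel₀ h0 (h.trans (one_mul _).symm))

end WeakConvergence

/-! ### Modulus bounds for the Fourier transform of one step -/

section Step

/-- The contribution to the Fourier transform of a step with mass `a` at a point where the
character is `c` and mass `p - a` at its inverse. -/
noncomputable def stepTerm (p a : ℝ) (c : ℂ) : ℂ := a * c + (p - a : ℝ) * starRingEnd ℂ c

variable {p a : ℝ} {c : ℂ}

theorem stepTerm_re : (stepTerm p a c).re = p * c.re := by
  simp [stepTerm]; ring

theorem stepTerm_im : (stepTerm p a c).im = (2 * a - p) * c.im := by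
  simp [stepTerm]; ring

theorem norm_stepTerm_sq (hc : ‖c‖ = 1) :
    ‖stepTerm p a c‖ ^ 2 = p ^ 2 - 4 * (a * (p - a)) * c.im ^ 2 := by
  have h : c.re ^ 2 + c.im ^ 2 = 1 := by
    rw [← one_pow 2, ← hc, Complex.sq_norm, Complex.normSq_apply]; ring
  rw [Complex.sq_norm, Complex.normSq_apply, stepTerm_re, stepTerm_im]
  linear_combination p ^ 2 * h

theorem norm_stepTerm_le (ha : a ∈ Set.Icc 0 p) (hc : ‖c‖ = 1) : ‖stepTerm p a c‖ ≤ p := by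
  refine abs_le_of_sq_le_sq' ?_ (ha.1.trans ha.2) |>.2
  rw [norm_stepTerm_sq hc]
  have := mul_nonneg ha.1 (sub_nonneg.2 ha.2)
  nlinarith [mul_nonneg this (sq_nonneg c.im)]

theorem norm_stepTerm_le_sub (hp : 0 < p) (ha : a ∈ Set.Icc 0 p) (hc : ‖c‖ = 1) :
    ‖stepTerm p a c‖ ≤ p - 2 / p * c.im ^ 2 * (a * (p - a)) := by
  have h1 := norm_stepTerm_sq (p := p) (a := a) hc
  have h2 := norm_stepTerm_le ha hc
  have h3 := norm_nonneg (stepTerm p a c)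
  have h4 : 2 * p * (p - ‖stepTerm p a c‖) ≥ 4 * (a * (p - a)) * c.im ^ 2 := by
    -- With `s` the modulus, `2p(p - s) = (p² - s²) + (p - s)² ≥ p² - s²`.
    nlinarith [mul_nonneg (sub_nonneg.2 h2) (sub_nonneg.2 h2)]
  have h5 : 2 / p * c.im ^ 2 * (a * (p - a)) = 4 * (a * (p - a)) * c.im ^ 2 / (2 * p) := by
    field_simp; ring
  have h6 : 4 * (a * (p - a)) * c.im ^ 2 / (2 * p) ≤ p - ‖stepTerm p a c‖ := by
    rw [div_le_iff₀ (by positivity)]; linarith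
  linarith

/-- Parallelogram law: both terms have modulus at most `p`, and their real parts, which do not
depend on `a` and `a'`, differ by `p * (c.re - c'.re)`. -/
theorem norm_stepTerm_add_le {a' : ℝ} {c' : ℂ} (ha : a ∈ Set.Icc 0 p) (hc : ‖c‖ = 1)
    (ha' : a' ∈ Set.Icc 0 p) (hc' : ‖c'‖ = 1) :
    ‖stepTerm p a c + stepTerm p a' c'‖ ≤ p * √(4 - (c.re - c'.re) ^ 2) := by
  have hp : 0 ≤ p := ha.1.trans ha.2
  have h1 := norm_stepTerm_le ha hc
  have h2 := norm_stepTerm_le ha' hc'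
  have h3 := parallelogram_law_with_norm ℝ (stepTerm p a c) (stepTerm p a' c')
  have h4 : (p * (c.re - c'.re)) ^ 2 ≤ ‖stepTerm p a c - stepTerm p a' c'‖ ^ 2 := by
    have h := Complex.abs_re_le_norm (stepTerm p a c - stepTerm p a' c')
    rw [Complex.sub_re, stepTerm_re, stepTerm_re, ← mul_sub] at h
    exact sq_le_sq.2 (by rwa [abs_norm])
  have h5 : ‖stepTerm p a c‖ ^ 2 ≤ p ^ 2 := pow_le_pow_left₀ (norm_nonneg _) h1 2
  have h6 : ‖stepTerm p a' c'‖ ^ 2 ≤ p ^ 2 := pow_le_pow_left₀ (norm_nonneg _) h2 2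
  have h7 : p * √(4 - (c.re - c'.re) ^ 2) = √(p ^ 2 * (4 - (c.re - c'.re) ^ 2)) := by
    rw [Real.sqrt_mul (sq_nonneg p), Real.sqrt_sq hp]
  rw [h7]
  apply Real.le_sqrt_of_sq_le
  nlinarith

variable {r : ℕ} {w : Fin r → ℝ} {z : Fin r → ℂ}

/-- Only the `k`-th term is estimated sharply, the others by `1 / r`; then `1 - t ≤ exp (-t)`. The
exponential form turns products over time into sums along the orbit. -/
theorem norm_sum_stepTerm_le_exp (hw : ∀ k, w k ∈ Set.Icc (0 : ℝ) (1 / r)) (hz : ∀ k, ‖z k‖ = 1)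
    (k : Fin r) :
    ‖∑ k, stepTerm (1 / r) (w k) (z k)‖ ≤
      Real.exp (-(2 * r * (z k).im ^ 2 * (w k * (1 / r - w k)))) := by
  have hr : (0 : ℝ) < r := by exact_mod_cast k.pos
  have h1 : ‖∑ k, stepTerm (1 / r) (w k) (z k)‖ ≤ ∑ k, ‖stepTerm (1 / r) (w k) (z k)‖ :=
    norm_sum_le _ _
  have h2 := norm_stepTerm_le_sub (one_div_pos.2 hr) (hw k) (hz k)
  rw [← Finset.add_sum_erase _ (fun k => ‖stepTerm (1 / r) (w k) (z k)‖) (Finset.mem_univ k)] at h1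
  have h3 : ∑ i ∈ Finset.univ.erase k, ‖stepTerm (1 / r) (w i) (z i)‖ ≤ 1 - 1 / r := by
    refine (Finset.sum_le_card_nsmul _ _ (1 / r : ℝ) fun i _ => norm_stepTerm_le (hw i) (hz i)).trans
      (le_of_eq ?_)
    rw [Finset.card_erase_of_mem (Finset.mem_univ k), Finset.card_univ, Fintype.card_fin,
      nsmul_eq_mul, Nat.cast_sub k.pos]
    field_simp
    simp
  rw [div_div_eq_mul_div, div_one] at h2
  have h4 := Real.add_one_le_exp (-(2 * r * (z k).im ^ 2 * (w k * (1 / r - w k))))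
  linarith

theorem norm_sum_stepTerm_le (hw : ∀ k, w k ∈ Set.Icc (0 : ℝ) (1 / r)) (hz : ∀ k, ‖z k‖ = 1)
    {k l : Fin r} (hkl : l ≠ k) :
    ‖∑ k, stepTerm (1 / r) (w k) (z k)‖ ≤ 1 - (2 - √(4 - ((z k).re - (z l).re) ^ 2)) / r := by
  have hr : (0 : ℝ) < r := by exact_mod_cast k.pos
  have hl : l ∈ Finset.univ.erase k := Finset.mem_erase.2 ⟨hkl, Finset.mem_univ l⟩
  have hcard : ((Finset.univ.erase k).erase l).card + 2 = r := by
    have h1 := Finset.card_erase_add_one hl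
    have h2 := Finset.card_erase_add_one (Finset.mem_univ k)
    rw [Finset.card_univ, Fintype.card_fin] at h2
    omega
  rw [← Finset.add_sum_erase _ _ (Finset.mem_univ k), ← Finset.add_sum_erase _ _ hl, ← add_assoc]
  have h1 := norm_stepTerm_add_le (hw k) (hz k) (hw l) (hz l)
  have h2 : ‖∑ i ∈ (Finset.univ.erase k).erase l, stepTerm (1 / r) (w i) (z i)‖ ≤ (r - 2) / r := by
    refine (norm_sum_le_of_le _ fun i _ => norm_stepTerm_le (hw i) (hz i)).trans (le_of_eq ?_)
    rw [Finset.sum_const, nsmul_eq_mul, mul_one_div]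
    congr 1
    have : ((((Finset.univ.erase k).erase l).card + 2 : ℕ) : ℝ) = r := by rw [hcard]
    push_cast at this
    linarith
  refine (norm_add_le _ _).trans ((add_le_add h1 h2).trans (le_of_eq ?_))
  field_simp
  ring

end Step

/-! ### Characters of the torus `K` -/

section TorusCharacter

variable {K : Type*} [Group K] [TopologicalSpace K] {r : ℕ}

/-- The character of `K` with frequency `m`, in torus coordinates `ψ`. -/
noncomputable def torusCharacter (ψ : UnitAddTorus (Fin r) ≃ₜ K)
    (hψ : ∀ x y, ψ (x + y) = ψ x * ψ y) (m : Fin r → ℤ) : K →* ℂ where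
  toFun g := UnitAddTorus.mFourier m (ψ.symm g)
  map_one' := by
    have h : ψ 0 = 1 := by
      have := hψ 0 0
      rwa [add_zero, left_eq_mul] at this
    rw [← h, ψ.symm_apply_apply]
    simp [UnitAddTorus.mFourier]
  map_mul' g h := by
    have hgh : ψ.symm (g * h) = ψ.symm g + ψ.symm h := by
      rw [ψ.symm_apply_eq, hψ, ψ.apply_symm_apply, ψ.apply_symm_apply]
    rw [hgh]
    simp only [UnitAddTorus.mFourier, ContinuousMap.coe_mk, Pi.add_apply, fourier_apply, smul_add,
      AddCircle.toCircle_add, Circle.coe_mul, Finset.prod_mul_distrib]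

variable (ψ : UnitAddTorus (Fin r) ≃ₜ K) (hψ : ∀ x y, ψ (x + y) = ψ x * ψ y) (m : Fin r → ℤ)

theorem continuous_torusCharacter : Continuous (torusCharacter ψ hψ m) :=
  (UnitAddTorus.mFourier m).continuous.comp ψ.symm.continuous

theorem norm_torusCharacter (g : K) : ‖torusCharacter ψ hψ m g‖ = 1 := by
  change ‖∏ i, (fourier (m i) (ψ.symm g i) : ℂ)‖ = 1
  rw [norm_prod]
  exact Finset.prod_eq_one fun i _ => Circle.norm_coe _

theorem torusCharacter_inv (g : K) :
    torusCharacter ψ hψ m g⁻¹ = starRingEnd ℂ (torusCharacter ψ hψ m g) := by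
  have h : torusCharacter ψ hψ m g⁻¹ * torusCharacter ψ hψ m g = 1 := by
    rw [← map_mul, inv_mul_cancel, map_one]
  rw [eq_inv_of_mul_eq_one_left h, Complex.inv_eq_conj (norm_torusCharacter ψ hψ m g)]

theorem torusCharacter_coordinate (k : Fin r) (t : ℝ) :
    torusCharacter ψ hψ m (ψ (fun j => ((Pi.single k t : Fin r → ℝ) j : UnitAddCircle))) =
      Complex.exp ((2 * Real.pi * (m k * t) : ℝ) * Complex.I) := by
  change UnitAddTorus.mFourier m (ψ.symm (ψ _)) = _
  rw [ψ.symm_apply_apply]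
  simp only [UnitAddTorus.mFourier, ContinuousMap.coe_mk]
  rw [Finset.prod_eq_single k]
  · rw [Pi.single_eq_same, fourier_coe_apply]
    congr 1
    push_cast
    ring
  · intro j _ hj
    rw [Pi.single_eq_of_ne hj]
    simp
  · simp

theorem span_torusCharacter_dense :
    (Submodule.span ℂ (Set.range fun m =>
      (⟨torusCharacter ψ hψ m, continuous_torusCharacter ψ hψ m⟩ :
        C(K, ℂ)))).topologicalClosure = ⊤ := by
  let Φ : C(UnitAddTorus (Fin r), ℂ) →ₗ[ℂ] C(K, ℂ) :=
    { toFun := fun F => F.comp ψ.symm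
      map_add' := fun _ _ => rfl
      map_smul' := fun _ _ => rfl }
  have hΦ : Continuous Φ := by
    change Continuous fun F : C(UnitAddTorus (Fin r), ℂ) =>
      F.comp (ψ.symm : C(K, UnitAddTorus (Fin r)))
    exact ContinuousMap.continuous_precomp _
  have hrange : (Set.range fun m => (⟨torusCharacter ψ hψ m, continuous_torusCharacter ψ hψ m⟩ :
      C(K, ℂ))) = Φ '' Set.range (UnitAddTorus.mFourier (d := Fin r)) := by
    rw [← Set.range_comp]
    rfl
  rw [hrange, ← Submodule.map_span, eq_top_iff]
  intro F _
  have hF : F = Φ (F.comp (ψ : C(UnitAddTorus (Fin r), K))) := by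
    ext g
    exact congrArg F (ψ.apply_symm_apply g).symm
  have hmem : F.comp (ψ : C(UnitAddTorus (Fin r), K)) ∈
      closure (Submodule.span ℂ (Set.range (UnitAddTorus.mFourier (d := Fin r))) : Set _) := by
    rw [← Submodule.topologicalClosure_coe, UnitAddTorus.span_mFourier_closure_eq_top]
    trivial
  rw [hF, ← SetLike.mem_coe, Submodule.topologicalClosure_coe, Submodule.map_coe]
  exact image_closure_subset_closure_image hΦ ⟨_, hmem, rfl⟩

end TorusCharacter

/-! ### Fourier transform of the walk and sums along orbits -/

section Walk

theorem integral_stepLaw {G E : Type*} [Group G] [MeasurableSpace G] [MeasurableSingletonClass G]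
    {r : ℕ} (e : Fin r → G) (f : Fin r → E → ℝ) (y : E)
    (hf : ∀ k, f k y ∈ Set.Icc (0 : ℝ) (1 / r)) (χ : G → ℂ)
    (hχ : ∀ g, χ g⁻¹ = starRingEnd ℂ (χ g)) :
    ∫ g, χ g ∂(stepLaw e f y) = ∑ k, stepTerm (1 / r) (f k y) (χ (e k)) := by
  have hd : ∀ (a : ℝ) (g : G), Integrable χ (ENNReal.ofReal a • Measure.dirac g) := fun a g =>
    (integrable_dirac enorm_lt_top).smul_measure ENNReal.ofReal_ne_top
  rw [stepLaw, integral_finsetSum_measure fun k _ => (hd _ _).add_measure (hd _ _)]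
  refine Finset.sum_congr rfl fun k _ => ?_
  rw [integral_add_measure (hd _ _) (hd _ _), integral_smul_measure, integral_smul_measure,
    integral_dirac, integral_dirac, ENNReal.toReal_ofReal (hf k).1,
    ENNReal.toReal_ofReal (sub_nonneg.2 (hf k).2), hχ, stepTerm, Complex.real_smul,
    Complex.real_smul]

theorem IsDynamicWalk.integral_prod {G E Ω : Type*} [Group G] [MeasurableSpace G]
    [MeasurableSpace Ω] {r : ℕ} {e : Fin r → G} {f : Fin r → E → ℝ} {τ : E → E} {x : E}
    {P : Measure Ω} {R : ℕ → Ω → G} (h : IsDynamicWalk e f τ x P R) (χ : G →* ℂ)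
    (hχ : Measurable χ) (n : ℕ) :
    ∫ ω, χ (List.ofFn fun j : Fin n => R ((j : ℕ) + 1) ω).prod ∂P =
      ∏ j ∈ Finset.range n, ∫ g, χ g ∂(stepLaw e f (τ^[j + 1] x)) := by
  have hind : iIndepFun (fun (j : Fin n) ω => χ (R ((j : ℕ) + 1) ω)) P :=
    (h.indep.precomp (g := fun j : Fin n => (j : ℕ)) Fin.val_injective).comp (fun _ => χ)
      fun _ => hχ
  have hmeas : ∀ j, AEMeasurable (R (j + 1)) P := fun j => (h.law (j + 1) (by omega)).aemeasurable
  have hprod := hind.integral_fun_prod_eq_prod_integral fun j =>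
    (hχ.comp_aemeasurable (hmeas j)).aestronglyMeasurable
  rw [Finset.prod_range]
  have hlist : ∀ ω, χ (List.ofFn fun j : Fin n => R ((j : ℕ) + 1) ω).prod =
      ∏ j : Fin n, χ (R ((j : ℕ) + 1) ω) := fun ω => by
    rw [map_list_prod, List.map_ofFn, List.prod_ofFn]
    rfl
  simp_rw [hlist, hprod]
  refine Finset.prod_congr rfl fun j _ => ?_
  rw [← (h.law (j + 1) (by omega)).map_eq,
    integral_map (hmeas j) hχ.aestronglyMeasurable]

theorem aemeasurable_list_ofFn_prod {G Ω : Type*} [Monoid G] [MeasurableSpace G] [MeasurableMul₂ G]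
    [MeasurableSpace Ω] {P : Measure Ω} {n : ℕ} {R : Fin n → Ω → G}
    (hR : ∀ j, AEMeasurable (R j) P) :
    AEMeasurable (fun ω => (List.ofFn fun j => R j ω).prod) P := by
  have := List.aemeasurable_fun_prod (μ := P) (List.ofFn R) fun f hf => by
    obtain ⟨j, rfl⟩ := (List.mem_ofFn' _ _).1 hf
    exact hR j
  simpa [List.map_ofFn, Function.comp_def] using this

theorem ClassC2.tendsto_sum_atTop {E : Type*} [MeasurableSpace E] {ρ : Measure E} {τ : E → E}
    {g : E → ℝ} (hg : ClassC2 ρ τ g) (hpos : 0 < ∫ y, g y ∂ρ) (x : E) :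
    Tendsto (fun n => ∑ i ∈ Finset.range n, g (τ^[i + 1] x)) atTop atTop := by
  -- The choice `ε = 1` is enough: an error of `√n` is negligible against the main term `n * I`.
  obtain ⟨N, hN⟩ := hg.2 1 one_pos
  set I := ∫ y, g y ∂ρ
  have hlow : ∀ᶠ n : ℕ in atTop, n * I - √n ≤ ∑ i ∈ Finset.range n, g (τ^[i + 1] x) := by
    filter_upwards [eventually_ge_atTop N] with n hn
    have h := (abs_le.1 (hN n hn x)).1
    rw [Finset.sum_sub_distrib, Finset.sum_const, Nat.card_Icc, nsmul_eq_mul] at h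
    have hs : ∑ i ∈ Finset.Icc 1 n, g (τ^[i] x) = ∑ i ∈ Finset.range n, g (τ^[i + 1] x) := by
      rw [Finset.range_eq_Ico, Finset.sum_Ico_add' (fun i => g (τ^[i] x)) 0 n 1]
      rfl
    rw [hs] at h
    simp only [Nat.add_sub_cancel] at h
    linarith
  refine tendsto_atTop_mono' _ hlow ?_
  have hsqrt : Tendsto (fun n : ℕ => √(n : ℝ)) atTop atTop :=
    Real.tendsto_sqrt_atTop.comp tendsto_natCast_atTop_atTop
  have h1 : Tendsto (fun n : ℕ => √(n : ℝ) * (√(n : ℝ) * I - 1)) atTop atTop :=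
    hsqrt.atTop_mul_atTop₀ (tendsto_atTop_add_const_right _ (-1) (hsqrt.atTop_mul_const hpos))
  refine h1.congr fun n => ?_
  linear_combination I * Real.mul_self_sqrt (Nat.cast_nonneg n)

end Walk

/-! ### Arithmetic of the angles, decay of the coefficients, conclusion -/

theorem sin_two_pi_int_mul_ne_zero {θ : ℝ} (hθ : Irrational θ) {m : ℤ} (hm : m ≠ 0) :
    Real.sin (2 * Real.pi * (m * θ)) ≠ 0 := fun h => by
  obtain ⟨n, hn⟩ := Real.sin_eq_zero_iff.1 h
  have h1 : Irrational (((2 * m : ℤ) : ℝ) * θ) :=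
    hθ.intCast_mul (mul_ne_zero two_ne_zero hm)
  refine h1.ne_int n ?_
  apply mul_right_cancel₀ Real.pi_ne_zero
  push_cast
  linarith

theorem cos_two_pi_int_mul_ne {r : ℕ} {θ : Fin r → ℝ}
    (hθ : LinearIndependent ℚ (Fin.cons 1 θ : Fin (r + 1) → ℝ)) {m : Fin r → ℤ} {k l : Fin r}
    (hkl : l ≠ k) (hm : m k ≠ 0) :
    Real.cos (2 * Real.pi * (m k * θ k)) ≠ Real.cos (2 * Real.pi * (m l * θ l)) := fun h => by
  -- Equal cosines mean angles equal or opposite modulo `2π`, the cases `s = -1` and `s = 1`. The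
  -- coefficient of `θ k` is `m k ≠ 0` in both, so `m l` may vanish.
  have key : ∀ (n s : ℤ), (m k : ℝ) * θ k + s * (m l * θ l) + n ≠ 0 := fun n s h0 => by
    have h1 := Fintype.linearIndependent_iff.1 hθ
      (Fin.cons (n : ℚ) (Pi.single k (m k : ℚ) + Pi.single l ((s * m l : ℤ) : ℚ))) (by
        rw [Fin.sum_univ_succ]
        simp only [Fin.cons_zero, Fin.cons_succ, Pi.add_apply, add_smul, Finset.sum_add_distrib]
        rw [Finset.sum_eq_single k (by intro b _ hb; simp [hb]) (by simp),
          Finset.sum_eq_single l (by intro b _ hb; simp [hb]) (by simp), Pi.single_eq_same,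
          Pi.single_eq_same, Rat.smul_def, Rat.smul_def, Rat.smul_def]
        push_cast
        linarith) k.succ
    rw [Fin.cons_succ, Pi.add_apply, Pi.single_eq_same, Pi.single_eq_of_ne hkl.symm, add_zero] at h1
    exact hm (by exact_mod_cast h1)
  obtain ⟨n, hn | hn⟩ := Real.cos_eq_cos_iff.1 h
  · refine key n (-1) (mul_left_cancel₀ Real.two_pi_pos.ne' ?_)
    push_cast
    linarith
  · refine key (-n) 1 (mul_left_cancel₀ Real.two_pi_pos.ne' ?_)
    push_cast
    linarith

/-- The Fourier coefficients of the walk at a nonzero frequency tend to zero. -/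
theorem tendsto_prod_stepTerm {r : ℕ} {θ : Fin r → ℝ} (hθ : ∀ k, Irrational (θ k))
    {E : Type*} [MeasurableSpace E] {ρ : Measure E} {τ : E → E}
    {f : Fin r → E → ℝ} (hf : ∀ k x, f k x ∈ Set.Icc (0 : ℝ) (1 / r))
    (hcase :
      (2 ≤ r ∧ LinearIndependent ℚ (Fin.cons 1 θ : Fin (r + 1) → ℝ)) ∨
      (∀ k, ClassC2 ρ τ (fun x => f k x * (1 / r - f k x)) ∧
        ¬ ∀ᵐ x ∂ρ, f k x = 0 ∨ f k x = 1 / r))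
    {m : Fin r → ℤ} {k : Fin r} (hk : m k ≠ 0) {z : Fin r → ℂ}
    (hz : ∀ k, z k = Complex.exp ((2 * Real.pi * (m k * θ k) : ℝ) * Complex.I)) (x : E) :
    Tendsto (fun n => ∏ j ∈ Finset.range n, ∑ k, stepTerm (1 / r) (f k (τ^[j + 1] x)) (z k))
      atTop (𝓝 0) := by
  have hz1 : ∀ k, ‖z k‖ = 1 := fun k => by rw [hz, Complex.norm_exp_ofReal_mul_I]
  have hr : (0 : ℝ) < r := by exact_mod_cast k.pos
  rw [tendsto_zero_iff_norm_tendsto_zero]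
  simp_rw [norm_prod]
  rcases hcase with ⟨hr2, hind⟩ | hcase
  · have : Nontrivial (Fin r) := Fin.nontrivial_iff_two_le.2 hr2
    obtain ⟨l, hl⟩ := exists_ne k
    have hne : (z k).re - (z l).re ≠ 0 := by
      rw [hz, hz, Complex.exp_ofReal_mul_I_re, Complex.exp_ofReal_mul_I_re, sub_ne_zero]
      exact cos_two_pi_int_mul_ne hind hl hk
    set q := 1 - (2 - √(4 - ((z k).re - (z l).re) ^ 2)) / r
    have hq1 : q < 1 := by
      have h1 : √(4 - ((z k).re - (z l).re) ^ 2) < 2 := by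
        rw [Real.sqrt_lt' two_pos]
        have : 0 < ((z k).re - (z l).re) ^ 2 := by positivity
        linarith
      have : 0 < (2 - √(4 - ((z k).re - (z l).re) ^ 2)) / r := div_pos (by linarith) hr
      simp only [q]
      linarith
    have hbound : ∀ y, ‖∑ k, stepTerm (1 / r) (f k y) (z k)‖ ≤ q := fun y =>
      norm_sum_stepTerm_le (fun k => hf k y) hz1 hl
    have hq0 : 0 ≤ q := (norm_nonneg _).trans (hbound x)
    refine squeeze_zero (fun n => Finset.prod_nonneg fun _ _ => norm_nonneg _) (fun n => ?_)
      (tendsto_pow_atTop_nhds_zero_of_lt_one hq0 hq1)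
    refine (Finset.prod_le_prod (fun _ _ => norm_nonneg _) fun j _ => hbound _).trans (le_of_eq ?_)
    rw [Finset.prod_const, Finset.card_range]
  · obtain ⟨hC, hae⟩ := hcase k
    have hg0 : ∀ y, 0 ≤ f k y * (1 / r - f k y) := fun y =>
      mul_nonneg (hf k y).1 (sub_nonneg.2 (hf k y).2)
    have hpos : 0 < ∫ y, f k y * (1 / r - f k y) ∂ρ := by
      refine lt_of_le_of_ne (integral_nonneg hg0) fun h => hae ?_
      have h1 := (integral_eq_zero_iff_of_nonneg hg0 hC.1).1 h.symm
      filter_upwards [h1] with y hy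
      rcases mul_eq_zero.1 hy with h2 | h2
      · exact Or.inl h2
      · exact Or.inr (sub_eq_zero.1 h2).symm
    have him : (z k).im ≠ 0 := by
      rw [hz, Complex.exp_ofReal_mul_I_im]
      exact sin_two_pi_int_mul_ne_zero (hθ k) hk
    have hc : 0 < 2 * r * (z k).im ^ 2 := by positivity
    refine squeeze_zero (fun n => Finset.prod_nonneg fun _ _ => norm_nonneg _) (fun n => ?_)
      (Real.tendsto_exp_neg_atTop_nhds_zero.comp
        ((hC.tendsto_sum_atTop hpos x).const_mul_atTop hc))
    refine (Finset.prod_le_prod (fun _ _ => norm_nonneg _) fun j _ =>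
      norm_sum_stepTerm_le_exp (fun k => hf k _) hz1 k).trans (le_of_eq ?_)
    rw [← Real.exp_sum, Finset.sum_neg_distrib, ← Finset.mul_sum]
    rfl

theorem mainTheorem4 {d r : ℕ}
    -- a compact connected abelian subgroup of SO(d), and its normalized Haar measure
    (K : Subgroup (SO d)) (hKcompact : IsCompact (K : Set (SO d)))
    (hKconn : IsConnected (K : Set (SO d))) (hKcomm : ∀ a ∈ K, ∀ b ∈ K, a * b = b * a)
    [MeasurableSpace K] [BorelSpace K]
    (haar : Measure K) [haar.IsHaarMeasure] [IsProbabilityMeasure haar]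
    -- coordinates on the Lie algebra, and the basis v with its only nonzero coordinates θ
    (u : Fin r → Matrix (Fin d) (Fin d) ℝ) (hu : IsTorusCoordinates K u)
    (v : Fin r → Matrix (Fin d) (Fin d) ℝ) (hv : IsLieBasis K v)
    (θ : Fin r → ℝ) (hθ : ∀ k, Irrational (θ k)) (hvu : ∀ k, v k = θ k • u k)
    (e : Fin r → K)
    (he : ∀ k, ((e k : SO d) : Matrix (Fin d) (Fin d) ℝ) = NormedSpace.exp (v k))
    -- the dynamical system
    {E : Type*} [MeasurableSpace E] (ρ : Measure E) [IsProbabilityMeasure ρ] (τ : E → E)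
    (f : Fin r → E → ℝ) (hf : ∀ k x, f k x ∈ Set.Icc (0 : ℝ) (1 / r))
    (hcase :
      (2 ≤ r ∧ LinearIndependent ℚ (Fin.cons 1 θ : Fin (r + 1) → ℝ)) ∨
      (∀ k, ClassC2 ρ τ (fun x => f k x * (1 / r - f k x)) ∧
        ¬ ∀ᵐ x ∂ρ, f k x = 0 ∨ f k x = 1 / r)) :
    ∀ᵐ x ∂ρ, ∀ (Ω : Type*) [MeasurableSpace Ω] (P : Measure Ω) [IsProbabilityMeasure P]
      (R : ℕ → Ω → K), IsDynamicWalk e f τ x P R →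
        TendstoInDistribution
          (fun (n : ℕ) ω => (List.ofFn fun j : Fin n => R ((j : ℕ) + 1) ω).prod)
          atTop (id : K → K) (fun _ => P) haar := by
  refine Eventually.of_forall fun x Ω _ P _ R hR => ?_
  have : ContinuousMul K := K.toSubmonoid.continuousMul
  have : CompactSpace K := isCompact_iff_compactSpace.1 hKcompact
  obtain ⟨ψ, hψ, hψu⟩ := exists_torus_homeomorph K hKcompact hKconn hKcomm u hu
  -- Second countability makes multiplication on `K` jointly Borel measurable, so that products of
  -- steps are measurable.
  have : SecondCountableTopology K := ψ.symm.isEmbedding.secondCountableTopology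
  have he' : ∀ k, e k = ψ (fun j => ((Pi.single k (θ k) : Fin r → ℝ) j : UnitAddCircle)) :=
      fun k => by
    apply Subtype.ext
    apply Subtype.ext
    rw [he, hψu, hvu, Finset.sum_eq_single k (by intro b _ hb; simp [hb]) (by simp),
      Pi.single_eq_same]
  have hχe : ∀ m k, torusCharacter ψ hψ m (e k) =
      Complex.exp ((2 * Real.pi * (m k * θ k) : ℝ) * Complex.I) := fun m k => by
    rw [he', torusCharacter_coordinate]
  have hmeas : ∀ n : ℕ,
      AEMeasurable (fun ω => (List.ofFn fun j : Fin n => R ((j : ℕ) + 1) ω).prod) P := fun n =>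
    aemeasurable_list_ofFn_prod fun j => (hR.law _ (by omega)).aemeasurable
  refine ⟨hmeas, aemeasurable_id, ?_⟩
  refine ProbabilityMeasure.tendsto_of_span_dense (span_torusCharacter_dense ψ hψ) ?_
  rintro _ ⟨m, rfl⟩
  simp only [ContinuousMap.coe_mk, ProbabilityMeasure.coe_mk, Measure.map_id]
  have hχm := (continuous_torusCharacter ψ hψ m).measurable
  simp_rw [integral_map (hmeas _) hχm.aestronglyMeasurable, hR.integral_prod _ hχm,
    integral_stepLaw e f _ (fun k => hf k _) _ (torusCharacter_inv ψ hψ m)]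
  by_cases hm : m = 0
  · have h1 : ∀ g, torusCharacter ψ hψ m g = 1 := fun g => by
      subst hm
      change UnitAddTorus.mFourier 0 (ψ.symm g) = 1
      rw [UnitAddTorus.mFourier_zero]
      rfl
    have h2 : ∀ n, ∏ j ∈ Finset.range n, ∑ k, stepTerm (1 / r) (f k (τ^[j + 1] x))
        (torusCharacter ψ hψ m (e k)) = 1 := fun n => by
      simp_rw [← integral_stepLaw e f _ (fun k => hf k _) _ (torusCharacter_inv ψ hψ m)]
      rw [← hR.integral_prod _ hχm]
      simp [h1]
    simp_rw [h2, h1]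
    simp
  · obtain ⟨k, hk⟩ := Function.ne_iff.1 hm
    -- Translating by `e k` shows that the Haar integral of this character vanishes.
    have hek : torusCharacter ψ hψ m (e k) ≠ 1 := fun h => by
      have h1 := congrArg Complex.im h
      rw [hχe, Complex.exp_ofReal_mul_I_im, Complex.one_im] at h1
      exact sin_two_pi_int_mul_ne_zero (hθ k) hk h1
    rw [integral_monoidHom_eq_zero haar _ hek]
    exact tendsto_prod_stepTerm hθ hf hcase hk (hχe m) x
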